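/- Let $0<\alpha<1$, let $(E_i)_{i\ge 1}$ be i.i.d. exponential random variables with parameter $\alpha$ (the landscape), and put $x_i=e^{-E_i}$. Given the landscape, for $N\ge 1$ let $(Y_N(t))_{t\ge 0}$, with law $\mathbb P_N$, be the (càdlàg) continuous-time random walk on $\{1,\dots,N\}$ with uniform initial distribution that jumps from $i$ to each $j\neq i$ at rate $x_i/N$; write $x_N(t)=x_{Y_N(t)}$. Fix $\delta>0$ and let $D_N=\{i\le N: x_i\ge\delta\}$ be the set of shallow traps. For $t,t_w\ge 0$ let $$\Pi_N(t,t_w)=\mathbb P_N\big(Y_N(s)=Y_N(t_w)\ \ \forall s\in[t_w,t_w+t]\big),$$ $$\Pi^{(1)}_N(t,t_w)=\mathbb P_N\big(Y_N(u)\in D_N\ \ \forall u\in(t_w,t_w+t]\text{ such that }Y_N(u)\ne Y_N(u^-)\big),$$ $$\Pi^{(2)}_N(t,t_w)=\mathbb P_N\big(Y_N(u)\in D_N\cup\{Y_N(t_w)\}\ \ \forall u\in(t_w,t_w+t]\text{ such that }x_N(u)\ne x_N(u^-)\big).$$ Then, for almost every landscape, $$\lim_{t_w\to\infty}\ \limsup_{N\to\infty}\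 \sup_{t\ge 0}\ \big|\Pi^{(i)}_N(t,t_w)-\Pi_N(t,t_w)\big|=0\qquad\text{for } i=1,2.$$ Hence $\Pi^{(1)}_N$ and $\Pi^{(2)}_N$ show the same ageing behaviour as $\Pi_N$: for almost every landscape, for all $\theta>0$, $\ell\in\mathbb R$ and $i=1,2$, $\lim_{t_w\to\infty}\limsup_{N\to\infty}|\Pi^{(i)}_N(\theta t_w,t_w)-\ell|=0$ if and only if $\lim_{t_w\to\infty}\limsup_{N\to\infty}|\Pi_N(\theta t_w,t_w)-\ell|=0$. -/

import Mathlib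

open Filter Topology MeasureTheory ProbabilityTheory
open scoped NNReal

noncomputable section

namespace TrapModel

/-- `(E i)` is an energy landscape on `(Ω, P)`: independent exponential random variables with
parameter `α`. -/
structure IsLandscape {Ω : Type*} [MeasurableSpace Ω] (P : Measure Ω) (α : ℝ)
    (E : ℕ → Ω → ℝ) : Prop where
  indep : iIndepFun E P
  law : ∀ i, HasLaw (E i) (expMeasure α) P

/-- The inverse waiting times `x_i = exp (-E_i)` of a realization `E` of the landscape. -/
def rates (E : ℕ → ℝ) (i : ℕ) : ℝ := Real.exp (-E i)

/-- The matrix `𝕃_N` on the `N` sites `0, …, N - 1`, with diagonal entries `(N - 1) x_i / N` and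
off-diagonal entries `-x_i / N`.  The walk jumps from `i` to `j ≠ i` at rate `x_i / N`, so its
transition probabilities are the entries of `exp (-t 𝕃_N)`. -/
def generator (x : ℕ → ℝ) (N : ℕ) : Matrix (Fin N) (Fin N) ℝ :=
  Matrix.of fun i j => if i = j then ((N : ℝ) - 1) * x i / N else -(x i / N)

/-- The transition probability `p_t(i, j) = (exp (-t 𝕃_N))_{i, j}`. -/
def transition (x : ℕ → ℝ) (N : ℕ) (t : ℝ) (i j : Fin N) : ℝ :=
  NormedSpace.exp (-(t • generator x N)) i j

/-- `i` is the left limit `y(u-)` of the path `y` (in a discrete space) at the time `u`. -/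
def IsLeftLimit {S : Type*} (y : ℝ≥0 → S) (u : ℝ≥0) (i : S) : Prop :=
  ∀ᶠ s in 𝓝[<] u, y s = i

/-- Right-continuous paths with left limits, in a discrete space. -/
def IsCadlagPath {S : Type*} (y : ℝ≥0 → S) : Prop :=
  (∀ u, ∀ᶠ s in 𝓝[>] u, y s = y u) ∧ ∀ u, 0 < u → ∃ i, IsLeftLimit y u i

/-- `Y` is, under the probability measure `μ`, the continuous-time random walk on the complete
graph with `N` sites, with jump rates `x_i / N` from `i` to each `j ≠ i` and with uniform initial
distribution: a process with almost surely càdlàg paths and with the finite-dimensional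
distributions of the Markov chain with transition semigroup `exp (-t 𝕃_N)`. -/
structure IsTrapWalk (x : ℕ → ℝ) (N : ℕ) {Ω' : Type*} [MeasurableSpace Ω'] (μ : Measure Ω')
    (Y : ℝ≥0 → Ω' → Fin N) : Prop where
  isProbabilityMeasure : IsProbabilityMeasure μ
  measurable : ∀ t, Measurable (Y t)
  cadlag : ∀ᵐ ω ∂μ, IsCadlagPath fun t => Y t ω
  fdd : ∀ (n : ℕ) (t : ℕ → ℝ≥0) (i : ℕ → Fin N), Monotone t → t 0 = 0 →
    μ.real {ω | ∀ k ≤ n, Y (t k) ω = i k} =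
      (1 / (N : ℝ)) * ∏ k ∈ Finset.range n,
        transition x N ((t (k + 1) : ℝ) - (t k : ℝ)) (i k) (i (k + 1))

/-- The set `D_N` of shallow traps: the sites with `x_i ≥ δ`. -/
def shallow (x : ℕ → ℝ) (δ : ℝ) (N : ℕ) : Set (Fin N) := {i | δ ≤ x i}

section Correlation

variable {Ω' : Type*} [MeasurableSpace Ω'] {N : ℕ}

/-- `Π_N(t, t_w)`: the probability of no jump during `[t_w, t_w + t]`. -/
def corr (μ : Measure Ω') (Y : ℝ≥0 → Ω' → Fin N) (t tw : ℝ≥0) : ℝ :=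
  μ.real {ω | ∀ s ∈ Set.Icc tw (tw + t), Y s ω = Y tw ω}

/-- `Π⁽¹⁾_N(t, t_w)`: the probability that `Y(u) ∈ D_N` for all `u ∈ (t_w, t_w + t]` such that
`Y(u) ≠ Y(u-)`. -/
def corr₁ (x : ℕ → ℝ) (δ : ℝ) (μ : Measure Ω') (Y : ℝ≥0 → Ω' → Fin N) (t tw : ℝ≥0) : ℝ :=
  μ.real {ω | ∀ u ∈ Set.Ioc tw (tw + t),
    (∃ i, IsLeftLimit (fun s => Y s ω) u i ∧ Y u ω ≠ i) → Y u ω ∈ shallow x δ N}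

/-- `Π⁽²⁾_N(t, t_w)`: the probability that `Y(u) ∈ D_N ∪ {Y(t_w)}` for all `u ∈ (t_w, t_w + t]`
such that `x_{Y(u)} ≠ x_{Y(u-)}`. -/
def corr₂ (x : ℕ → ℝ) (δ : ℝ) (μ : Measure Ω') (Y : ℝ≥0 → Ω' → Fin N) (t tw : ℝ≥0) : ℝ :=
  μ.real {ω | ∀ u ∈ Set.Ioc tw (tw + t),
    (∃ i, IsLeftLimit (fun s => Y s ω) u i ∧ x (Y u ω) ≠ x i) →
      Y u ω ∈ shallow x δ N ∪ {Y tw ω}}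

end Correlation

/-- `lim_{t_w → ∞} limsup_{N → ∞} sup_{t ≥ 0} |A_N(t, t_w) - B_N(t, t_w)| = 0`. -/
def AsympEqual (A B : ℕ → ℝ≥0 → ℝ≥0 → ℝ) : Prop :=
  Tendsto (fun tw : ℝ≥0 => limsup (fun N : ℕ => ⨆ t : ℝ≥0, |A N t tw - B N t tw|) atTop)
    atTop (𝓝 0)

/-- `lim_{t_w → ∞} limsup_{N → ∞} |A_N(θ t_w, t_w) - ℓ| = 0`, that is, `A_N(θ t_w, t_w)` tends to
`ℓ` as `N → ∞` and then `t_w → ∞`. -/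
def AgesTo (A : ℕ → ℝ≥0 → ℝ≥0 → ℝ) (θ : ℝ≥0) (ℓ : ℝ) : Prop :=
  Tendsto (fun tw : ℝ≥0 => limsup (fun N : ℕ => |A N (θ * tw) tw - ℓ|) atTop) atTop (𝓝 0)

end TrapModel

end

/-!
A path counted by `corr₁` but not by `corr` jumps during `(tw, tw + t]`, and its last jump lands in
a shallow trap, so that it is in a shallow trap at the time `tw + t`. A path counted by `corr₂` but
not by `corr` is either in a shallow trap at the time `tw + t`, or has left the deep trap `Y tw`,
moved through shallow traps only, and returned (the rates `x i` are almost surely distinct, so that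
the jumps of `x_N` are those of `Y`). Both events are unlikely, uniformly in `t`.

*Shallow traps are rarely occupied at late times.* The mean `v` of the rate `x_N` is nonincreasing:
by reversibility, `v s = N * ∑ j, x j * q j (s / 2) ^ 2` for the occupation probabilities `q j`
(`meanRate_eq_sum_sq`), and the derivative of this sum is nonpositive by the Cauchy-Schwarz
inequality (`antitone_meanRate`). By the master equation, each site `j` thus receives mass at a rate
of at least `v s / N` up to the time `s`, and loses it at the rate `x j`. As the total mass is `1`,
`v s` is at most twice the inverse of the average of `min s (x j)⁻¹` (`meanRate_mul_average_le`).
By the law of large numbers the average is close to the mean of `min s (exp (E 0))`, which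
tends to infinity with `s`, since `exp (E 0)` has an infinite mean for `α < 1`. By Markov's inequality, a shallow trap is occupied at the time `tw + t` with a probability
of at most `v tw / δ`.

*Returns through shallow traps are rare.* From any shallow trap, all the deep traps are equally
likely to be hit next, so the starting point is the first one to be hit with a probability of order
`1 / m`, where `m` is the number of deep traps (`IsTrapWalk.measureReal_returnsThrough_le`). As only
the finite-dimensional distributions are given, the walk is observed on a grid of mesh `t / n`:
there, the probability of ending the stay in the shallow traps at a given step by returning is at
most `2 / m` times that of ending it at that step, the latter events being disjoint for different
steps. As `n → ∞` this bounds the probability of the return. Finally `m → ∞` as `N → ∞`.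
-/

namespace TrapModel

/-! ### The master equation and the mean rate -/

section MasterEquation

attribute [local instance] Matrix.linftyOpNormedAddCommGroup Matrix.linftyOpNormedSpace
  Matrix.linftyOpNormedRing Matrix.linftyOpNormedAlgebra

lemma transition_zero (x : ℕ → ℝ) (N : ℕ) (i j : Fin N) :
    transition x N 0 i j = (1 : Matrix (Fin N) (Fin N) ℝ) i j := by
  simp [transition]

/-- The forward equation for the transition semigroup. -/
lemma hasDerivAt_transition (x : ℕ → ℝ) (N : ℕ) (i j : Fin N) (s : ℝ) :
    HasDerivAt (fun s => transition x N s i j)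
      (-∑ k, transition x N s i k * generator x N k j) s := by
  have h := hasDerivAt_exp_smul_const (𝕂 := ℝ) (-generator x N) s
  have e : (fun s => transition x N s i j) =
      fun s : ℝ => NormedSpace.exp (s • (-generator x N)) i j := by
    funext s
    simp [transition]
  rw [e]
  refine (hasDerivAt_pi.1 (hasDerivAt_pi.1 h i) j).congr_deriv ?_
  simp only [mul_neg, Matrix.neg_apply, Matrix.mul_apply, transition, smul_neg,
    Finset.sum_neg_distrib]
  rfl

end MasterEquation

lemma generator_apply (x : ℕ → ℝ) {N : ℕ} (hN : 1 ≤ N) (i j : Fin N) :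
    generator x N i j = (if i = j then x i else 0) - x i / N := by
  have : (N : ℝ) ≠ 0 := by positivity
  rw [generator, Matrix.of_apply]
  split_ifs
  · field_simp
  · ring

/-- The probability of being at `j` at time `s`, started from the uniform distribution. -/
noncomputable def occupation (x : ℕ → ℝ) (N : ℕ) (s : ℝ) (j : Fin N) : ℝ :=
  (1 / (N : ℝ)) * ∑ i, transition x N s i j

/-- The mean of the rate `x_N(s) = x_{Y_N(s)}` at time `s`. -/
noncomputable def meanRate (x : ℕ → ℝ) (N : ℕ) (s : ℝ) : ℝ :=
  ∑ j : Fin N, x j * occupation x N s j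

lemma occupation_zero (x : ℕ → ℝ) (N : ℕ) (j : Fin N) : occupation x N 0 j = 1 / N := by
  simp [occupation, transition_zero, Matrix.one_apply]

/-- The master equation: the total flow out of the sites is redistributed uniformly. -/
lemma hasDerivAt_occupation (x : ℕ → ℝ) {N : ℕ} (hN : 1 ≤ N) (j : Fin N) (s : ℝ) :
    HasDerivAt (fun s => occupation x N s j)
      (-(x j * occupation x N s j) + meanRate x N s / N) s := by
  have h := (HasDerivAt.fun_sum (u := Finset.univ) fun i _ =>
    hasDerivAt_transition x N i j s).const_mul (1 / (N : ℝ))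
  refine h.congr_deriv ?_
  simp only [generator_apply x hN, mul_sub, Finset.sum_sub_distrib, mul_ite, mul_zero,
    Finset.sum_ite_eq', Finset.mem_univ, if_true, meanRate, occupation, neg_sub]
  rw [Finset.sum_comm]
  simp only [← Finset.sum_mul, Finset.mul_sum, Finset.sum_div]
  rw [sub_eq_add_neg, add_comm]
  congr 1
  · simp only [Finset.sum_mul, Finset.mul_sum, ← Finset.sum_neg_distrib]
    exact Finset.sum_congr rfl fun i _ => by ring
  · refine Finset.sum_congr rfl fun i _ => ?_
    simp only [Finset.sum_mul, Finset.mul_sum]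
    exact Finset.sum_congr rfl fun i _ => by ring

/-- By reversibility with respect to the weights `1 / x j`, the pairing
`∑ j, x j * q j r * q j (s - r)` of the occupation probabilities `q` does not depend on `r`; it is
evaluated here at `r = 0` and at `r = s / 2`. -/
lemma meanRate_eq_sum_sq (x : ℕ → ℝ) {N : ℕ} (hN : 1 ≤ N) (s : ℝ) :
    meanRate x N s = N * ∑ j : Fin N, x j * occupation x N (s / 2) j ^ 2 := by
  have hN0 : (N : ℝ) ≠ 0 := by positivity
  set g : ℝ → ℝ := fun r => ∑ j : Fin N, x j * (occupation x N r j * occupation x N (s - r) j)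
    with hg
  have hd : ∀ r, HasDerivAt g 0 r := by
    intro r
    have h1 : ∀ j : Fin N, HasDerivAt (fun r => occupation x N (s - r) j)
        (-(-(x j * occupation x N (s - r) j) + meanRate x N (s - r) / N)) r := fun j =>
      (hasDerivAt_occupation x hN j (s - r)).comp_const_sub s r
    have h := HasDerivAt.fun_sum (u := Finset.univ) fun j _ =>
      ((hasDerivAt_occupation x hN j r).mul (h1 j)).const_mul (x j)
    refine h.congr_deriv ?_
    calc _ = ∑ j : Fin N, (meanRate x N r / N * (x j * occupation x N (s - r) j) -
            meanRate x N (s - r) / N * (x j * occupation x N r j)) :=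
          Finset.sum_congr rfl fun j _ => by ring
      _ = 0 := by
          rw [Finset.sum_sub_distrib, ← Finset.mul_sum, ← Finset.mul_sum, ← meanRate, ← meanRate]
          ring
  have hc := is_const_of_deriv_eq_zero (fun r => (hd r).differentiableAt)
    (fun r => (hd r).deriv) 0 (s / 2)
  simp only [hg, occupation_zero, sub_zero] at hc
  rw [show s - s / 2 = s / 2 by ring] at hc
  simp only [← sq] at hc
  rw [← hc, meanRate, Finset.mul_sum]
  exact Finset.sum_congr rfl fun j _ => by field_simp

lemma antitone_meanRate (x : ℕ → ℝ) {N : ℕ} (hN : 1 ≤ N) : Antitone (meanRate x N) := by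
  have hN0 : (0 : ℝ) < N := by positivity
  set z : ℝ → ℝ := fun r => N * ∑ j : Fin N, x j * occupation x N r j ^ 2 with hz
  have hd : ∀ r, HasDerivAt z (N * ∑ j : Fin N, x j * (2 * occupation x N r j *
      (-(x j * occupation x N r j) + meanRate x N r / N))) r := by
    intro r
    have h := (HasDerivAt.fun_sum (u := Finset.univ) fun j _ =>
      ((hasDerivAt_occupation x hN j r).pow 2).const_mul (x j)).const_mul (N : ℝ)
    refine h.congr_deriv ?_
    simp
  have hz' : Antitone z := by
    refine antitone_of_deriv_nonpos (fun r => (hd r).differentiableAt) fun r => ?_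
    rw [(hd r).deriv]
    have hcs := sq_sum_le_card_mul_sum_sq (s := Finset.univ)
      (f := fun j : Fin N => x j * occupation x N r j)
    rw [← meanRate, Finset.card_univ, Fintype.card_fin] at hcs
    have : (N : ℝ) * ∑ j : Fin N, x j * (2 * occupation x N r j *
        (-(x j * occupation x N r j) + meanRate x N r / N)) =
        2 * (meanRate x N r ^ 2 - N * ∑ j : Fin N, (x j * occupation x N r j) ^ 2) := by
      have : ∑ j : Fin N, x j * (2 * occupation x N r j *
          (-(x j * occupation x N r j) + meanRate x N r / N)) =
          2 * (meanRate x N r / N) * meanRate x N r -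
            2 * ∑ j : Fin N, (x j * occupation x N r j) ^ 2 := by
        conv_rhs => rw [meanRate, Finset.mul_sum, Finset.mul_sum, ← Finset.sum_sub_distrib]
        exact Finset.sum_congr rfl fun j _ => by rw [meanRate]; ring
      rw [this]
      field_simp
    rw [this]
    linarith
  intro a b hab
  rw [meanRate_eq_sum_sq x hN, meanRate_eq_sum_sq x hN]
  exact hz' (by linarith)

/-- Mass conservation against the flow into the sites. As the mean rate is nonincreasing, at
least `meanRate s / N` flows into the site `j` per unit time up to the time `s`, and a
proportion `exp (-x_j r)` of it is still there after a time `r`. -/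
lemma meanRate_mul_le_occupation {x : ℕ → ℝ} (hx : ∀ i, 0 < x i) {N : ℕ} (hN : 1 ≤ N) {s : ℝ}
    (hs : 0 ≤ s) (j : Fin N) :
    meanRate x N s / N * ((1 - Real.exp (-(x j * s))) / x j) ≤ occupation x N s j := by
  have hN0 : (0 : ℝ) < N := by positivity
  have hxj := hx j
  set F : ℝ → ℝ := fun r => Real.exp (x j * r) * occupation x N r j -
    meanRate x N s / N * (Real.exp (x j * r) / x j) with hF
  have hd : ∀ r, HasDerivAt F
      (Real.exp (x j * r) * ((meanRate x N r - meanRate x N s) / N)) r := by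
    intro r
    have he : HasDerivAt (fun r => Real.exp (x j * r)) (Real.exp (x j * r) * x j) r := by
      simpa using ((hasDerivAt_id r).const_mul (x j)).exp
    have h := (he.mul (hasDerivAt_occupation x hN j r)).sub
      ((he.div_const (x j)).const_mul (meanRate x N s / N))
    refine h.congr_deriv ?_
    field_simp
    ring
  have hmono : MonotoneOn F (Set.Icc 0 s) := by
    refine monotoneOn_of_deriv_nonneg (convex_Icc 0 s)
      (fun r _ => (hd r).continuousAt.continuousWithinAt)
      (fun r _ => (hd r).differentiableAt.differentiableWithinAt) fun r hr => ?_
    rw [interior_Icc] at hr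
    rw [(hd r).deriv]
    have := antitone_meanRate x hN hr.2.le
    exact mul_nonneg (Real.exp_pos _).le (div_nonneg (by linarith) hN0.le)
  have h := hmono (Set.left_mem_Icc.2 hs) (Set.right_mem_Icc.2 hs) hs
  simp only [hF, mul_zero, Real.exp_zero, occupation_zero] at h
  have hE : Real.exp (-(x j * s)) * Real.exp (x j * s) = 1 := by
    rw [← Real.exp_add]; simp
  have hpos := Real.exp_pos (-(x j * s))
  have h3 : 0 ≤ Real.exp (-(x j * s)) * (1 / N) := by positivity
  have h2 := mul_le_mul_of_nonneg_left h hpos.le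
  have h4 : Real.exp (-(x j * s)) * (Real.exp (x j * s) * occupation x N s j -
      meanRate x N s / N * (Real.exp (x j * s) / x j)) =
      occupation x N s j - meanRate x N s / N / x j := by
    linear_combination (occupation x N s j - meanRate x N s / N / x j) * hE
  rw [h4] at h2
  calc _ = meanRate x N s / N / x j - Real.exp (-(x j * s)) * (meanRate x N s / N * (1 / x j)) := by
        ring
    _ ≤ _ := by linarith

lemma min_div_two_le {x s : ℝ} (hx : 0 < x) (hs : 0 ≤ s) :
    min s x⁻¹ / 2 ≤ (1 - Real.exp (-(x * s))) / x := by
  have h1 : Real.exp (-(x * s)) ≤ 1 / (1 + x * s) := by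
    rw [Real.exp_neg, ← one_div]
    have := Real.add_one_le_exp (x * s)
    exact one_div_le_one_div_of_le (by positivity) (by linarith)
  have h2 : s / (1 + x * s) ≤ (1 - Real.exp (-(x * s))) / x := by
    rw [le_div_iff₀ hx]
    have : s / (1 + x * s) * x = 1 - 1 / (1 + x * s) := by
      field_simp; ring
    linarith
  refine le_trans ?_ h2
  rw [div_le_div_iff₀ two_pos (by positivity)]
  rcases le_total (x * s) 1 with h | h
  · have := min_le_left s x⁻¹
    have h0 : 0 ≤ min s x⁻¹ := le_min hs (by positivity)
    nlinarith
  · have := min_le_right s x⁻¹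
    have h3 : min s x⁻¹ * x ≤ 1 := by
      calc _ ≤ x⁻¹ * x := by gcongr
        _ = 1 := by field_simp
    have h4 := min_le_left s x⁻¹
    nlinarith

/-- The mean rate at the time `s` is at most twice the inverse of the average over the sites of
the mean waiting time truncated at `s`. -/
lemma meanRate_mul_average_le {x : ℕ → ℝ} (hx : ∀ i, 0 < x i) {N : ℕ} (hN : 1 ≤ N) {s : ℝ}
    (hs : 0 ≤ s) (hsum : ∑ j, occupation x N s j = 1) (hv : 0 ≤ meanRate x N s) :
    meanRate x N s * ((∑ j ∈ Finset.range N, min s (x j)⁻¹) / N) ≤ 2 := by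
  have hN0 : (0 : ℝ) < N := by positivity
  have h : ∑ j : Fin N, meanRate x N s / N * (min s (x j)⁻¹ / 2) ≤ 1 := by
    rw [← hsum]
    refine Finset.sum_le_sum fun j _ => le_trans ?_ (meanRate_mul_le_occupation hx hN hs j)
    exact mul_le_mul_of_nonneg_left (min_div_two_le (hx j) hs) (by positivity)
  rw [← Finset.mul_sum, ← Finset.sum_div, Fin.sum_univ_eq_sum_range (fun j => min s (x j)⁻¹)] at h
  calc _ = 2 * (meanRate x N s / N * ((∑ j ∈ Finset.range N, min s (x j)⁻¹) / 2)) := by ring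
    _ ≤ _ := by linarith

/-! ### Last jumps and returns of càdlàg paths -/

section Paths

variable {S : Type*} {y : ℝ≥0 → S}

/-- The last jump: a càdlàg path which is not constant on `[a, b]` has a jump in `(a, b]` which
lands at its terminal position. -/
lemma IsCadlagPath.const_or_exists_jump (hy : IsCadlagPath y) {a b : ℝ≥0} (hab : a ≤ b) :
    (∀ s ∈ Set.Icc a b, y s = y a) ∨
      ∃ u ∈ Set.Ioc a b, y u = y b ∧ ∃ i, IsLeftLimit y u i ∧ y u ≠ i := by
  set T : Set ℝ≥0 := {u | u ∈ Set.Icc a b ∧ ∀ s ∈ Set.Icc u b, y s = y b} with hT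
  have hbT : b ∈ T := ⟨⟨hab, le_rfl⟩, fun s hs => by rw [le_antisymm hs.2 hs.1]⟩
  have hbdd : BddBelow T := ⟨a, fun u hu => hu.1.1⟩
  have hau : a ≤ sInf T := le_csInf ⟨b, hbT⟩ fun u hu => hu.1.1
  have hub : sInf T ≤ b := csInf_le hbdd hbT
  have hIoc : ∀ s ∈ Set.Ioc (sInf T) b, y s = y b := fun s hs => by
    obtain ⟨u, hu, hus⟩ := exists_lt_of_csInf_lt ⟨b, hbT⟩ hs.1
    exact hu.2 s ⟨hus.le, hs.2⟩
  have hu0 : y (sInf T) = y b := by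
    rcases hub.eq_or_lt with h | h
    · rw [h]
    · have hev : ∀ᶠ s in 𝓝[>] sInf T, s ∈ Set.Ioc (sInf T) b := Ioc_mem_nhdsGT h
      obtain ⟨s, hs1, hs2⟩ := ((hy.1 (sInf T)).and hev).exists
      rw [← hs1, hIoc s hs2]
  rcases hau.eq_or_lt with h | h
  · left
    intro s hs
    rw [← h] at hu0 hIoc
    rcases hs.1.eq_or_lt with h' | h'
    · rw [h']
    · rw [hIoc s ⟨h', hs.2⟩, hu0]
  · right
    refine ⟨sInf T, ⟨h, hub⟩, hu0, ?_⟩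
    obtain ⟨i, hi⟩ := hy.2 _ (lt_of_le_of_lt (zero_le) h)
    refine ⟨i, hi, fun hne => ?_⟩
    obtain ⟨l, hl, hlT⟩ := (mem_nhdsLT_iff_exists_Ioo_subset' h).1 hi
    obtain ⟨m, hm1, hm2⟩ := exists_between (max_lt hl h : max l a < sInf T)
    have hmT : m ∈ T := by
      refine ⟨⟨(le_max_right _ _).trans hm1.le, hm2.le.trans hub⟩, fun s hs => ?_⟩
      rcases lt_trichotomy s (sInf T) with h' | h' | h'
      · have : y s = i := hlT ⟨(le_max_left _ _).trans_lt (hm1.trans_le hs.1), h'⟩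
        rw [this, ← hne, hu0]
      · rw [h', hu0]
      · exact hIoc s ⟨h', hs.2⟩
    exact absurd (csInf_le hbdd hmT) (not_le.2 hm2)

lemma not_jump_of_const {a b : ℝ≥0} (h : ∀ s ∈ Set.Icc a b, y s = y a) {u : ℝ≥0}
    (hu : u ∈ Set.Ioc a b) {i : S} (hi : IsLeftLimit y u i) : y u = i := by
  have hlt : a < u := hu.1
  have hne : (𝓝[<] u).NeBot := nhdsLT_neBot_of_exists_lt ⟨a, hlt⟩
  have hev : ∀ᶠ s in 𝓝[<] u, s ∈ Set.Ioo a u := Ioo_mem_nhdsLT hlt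
  obtain ⟨s, hs1, hs2⟩ := (hi.and hev).exists
  rw [h u ⟨hu.1.le, hu.2⟩, ← hs1, h s ⟨hs2.1.le, hs2.2.le.trans hu.2⟩]

/-- The path `y` is at the times `a` and `b` at the same site outside `D`, and in between it visits
some site of `D`, but no other site outside `D`. -/
def ReturnsThrough (y : ℝ≥0 → S) (D : Set S) (a b : ℝ≥0) : Prop :=
  y a ∉ D ∧ y b = y a ∧ (∃ s ∈ Set.Icc a b, y s ∈ D) ∧
    ∀ s ∈ Set.Icc a b, y s ∈ D ∪ {y a}

/-- If all jumps land in `D`, then a path which is not constant ends in `D`. -/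
lemma IsCadlagPath.const_or_mem_of_jumps (hy : IsCadlagPath y) {D : Set S} {a b : ℝ≥0}
    (hab : a ≤ b)
    (h : ∀ u ∈ Set.Ioc a b, (∃ i, IsLeftLimit y u i ∧ y u ≠ i) → y u ∈ D) :
    (∀ s ∈ Set.Icc a b, y s = y a) ∨ y b ∈ D := by
  refine (hy.const_or_exists_jump hab).imp_right ?_
  rintro ⟨u, hu, hub, hj⟩
  rw [← hub]
  exact h u hu hj

lemma IsCadlagPath.const_or_mem_or_returnsThrough (hy : IsCadlagPath y) {D : Set S} {a b : ℝ≥0}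
    (hab : a ≤ b)
    (h : ∀ u ∈ Set.Ioc a b, (∃ i, IsLeftLimit y u i ∧ y u ≠ i) → y u ∈ D ∪ {y a}) :
    (∀ s ∈ Set.Icc a b, y s = y a) ∨ y b ∈ D ∨ ReturnsThrough y D a b := by
  have hall : ∀ s ∈ Set.Icc a b, y s ∈ D ∪ {y a} := fun s hs => by
    rcases hy.const_or_exists_jump hs.1 with h' | ⟨u, hu, hub, hj⟩
    · exact Or.inr (h' s ⟨hs.1, le_rfl⟩)
    · rw [← hub]
      exact h u ⟨hu.1, hu.2.trans hs.2⟩ hj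
  by_cases hc : ∀ s ∈ Set.Icc a b, y s = y a
  · exact Or.inl hc
  by_cases hb : y b ∈ D
  · exact Or.inr (Or.inl hb)
  refine Or.inr (Or.inr ?_)
  have hba : y b = y a := (hall b ⟨hab, le_rfl⟩).resolve_left hb
  push Not at hc
  obtain ⟨s, hs, hne⟩ := hc
  exact ⟨hba ▸ hb, hba, ⟨s, hs, (hall s hs).resolve_right hne⟩, hall⟩

/-- The discrete path `z` stays at its starting point `z 0`, which is not in `D`, until it enters
`D` at some step `m ≤ k`, and it does not leave `D` from then on up to the step `k`. -/
def InFirstStay (D : Set S) (k : ℕ) (z : ℕ → S) : Prop :=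
  z 0 ∉ D ∧ ∃ m ≤ k, (∀ l < m, z l = z 0) ∧ ∀ l, m ≤ l → l ≤ k → z l ∈ D

lemma InFirstStay.congr {D : Set S} {k : ℕ} {z z' : ℕ → S} (h : ∀ l ≤ k, z l = z' l)
    (hz : InFirstStay D k z) : InFirstStay D k z' := by
  obtain ⟨h0, m, hm, h1, h2⟩ := hz
  have e0 := h 0 (Nat.zero_le k)
  refine ⟨e0 ▸ h0, m, hm, fun l hl => ?_, fun l hl hlk => h l hlk ▸ h2 l hl hlk⟩
  rw [← h l (hl.le.trans hm), ← e0, h1 l hl]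

/-- There is only one step at which the first stay in `D` ends. -/
lemma InFirstStay.le_of_notMem {D : Set S} {k k' : ℕ} {z : ℕ → S} (hz : InFirstStay D k z)
    (hk : z (k + 1) ∉ D) (hz' : InFirstStay D k' z) : k' ≤ k := by
  obtain ⟨h0, m, hm, -, h2⟩ := hz
  obtain ⟨-, m', hm', h1', h2'⟩ := hz'
  by_contra hlt
  push Not at hlt
  have hmk : m' ≤ k := by
    by_contra hc
    push Not at hc
    exact h0 (h1' k hc ▸ h2 k hm le_rfl)
  exact hk (h2' (k + 1) (by omega) hlt)

lemma exists_inFirstStay_and_return {D : Set S} {z : ℕ → S} {n : ℕ} (h0 : z 0 ∉ D)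
    (hn : z n = z 0) (hl : ∃ l ≤ n, z l ∈ D) (hall : ∀ l ≤ n, z l ∈ D ∪ {z 0}) :
    ∃ k < n, InFirstStay D k z ∧ z (k + 1) = z 0 := by
  classical
  obtain ⟨l, hln, hlD⟩ := hl
  have hex : ∃ l, z l ∈ D := ⟨l, hlD⟩
  set m := Nat.find hex with hm
  have hmD : z m ∈ D := Nat.find_spec hex
  have hml : m ≤ l := Nat.find_min' hex hlD
  have hmn : m < n := lt_of_le_of_ne (hml.trans hln) fun h => h0 (hn ▸ h ▸ hmD)
  have hex' : ∃ k, m ≤ k ∧ z (k + 1) ∉ D := ⟨n - 1, by omega, by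
    rw [Nat.sub_add_cancel (by omega), hn]; exact h0⟩
  have hkn : Nat.find hex' ≤ n - 1 := Nat.find_min' hex' ⟨by omega, by
    rw [Nat.sub_add_cancel (by omega), hn]; exact h0⟩
  obtain ⟨hk1, hk2⟩ := Nat.find_spec hex'
  refine ⟨Nat.find hex', by omega, ⟨h0, m, hk1, fun i hi => ?_, fun i => ?_⟩,
    (hall _ (by omega)).resolve_left hk2⟩
  · exact (hall i (by omega)).resolve_left (Nat.find_min hex hi)
  · intro hmi hik
    rcases hmi.eq_or_lt with h | h
    · rw [← h]; exact hmD
    · by_contra hc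
      refine Nat.find_min hex' (m := i - 1) (by omega) ⟨by omega, ?_⟩
      rwa [Nat.sub_add_cancel (by omega)]

/-- On a sufficiently fine grid, a path which returns through `D` is seen to do so. -/
lemma ReturnsThrough.eventually_exists_inFirstStay (hy : IsCadlagPath y) {D : Set S}
    {a t : ℝ≥0} (h : ReturnsThrough y D a (a + t)) :
    ∀ᶠ n : ℕ in atTop, ∃ k < n, InFirstStay D k (fun k => y (a + k * (t / n))) ∧
      y (a + (k + 1 : ℕ) * (t / n)) = y a := by
  obtain ⟨h0, hb, ⟨s, hs, hsD⟩, hall⟩ := h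
  have hsb : s < a + t := lt_of_le_of_ne hs.2 fun e => h0 (hb ▸ e ▸ hsD)
  have hsa : a < s := lt_of_le_of_ne hs.1 fun e => h0 (e ▸ hsD)
  have hev : ∀ᶠ r in 𝓝[>] s, y r ∈ D := (hy.1 s).mono fun r hr => hr ▸ hsD
  obtain ⟨v, hv, hvD⟩ := (mem_nhdsGT_iff_exists_Ioo_subset' hsb).1 hev
  have hv : s < v := hv
  have ht : 0 < t := by
    have := hsa.trans hsb
    exact pos_of_lt_add_right this
  have hlim : Tendsto (fun n : ℕ => t / (n : ℝ≥0)) atTop (𝓝 0) := by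
    rw [← NNReal.tendsto_coe]
    simpa using tendsto_const_div_atTop_nhds_zero_nat (t : ℝ)
  have hvs : 0 < min v (a + t) - s := tsub_pos_of_lt (lt_min hv hsb)
  filter_upwards [hlim.eventually_lt_const hvs, eventually_gt_atTop 0] with n hn hn0
  have hn0' : (0 : ℝ) < n := by exact_mod_cast hn0
  have hgrid : ∀ l ≤ n, a + (l : ℝ≥0) * (t / n) ∈ Set.Icc a (a + t) := fun l hl => by
    refine ⟨le_self_add, ?_⟩
    gcongr
    have : (l : ℝ) ≤ n := by exact_mod_cast hl
    rw [← NNReal.coe_le_coe]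
    push_cast
    calc (l : ℝ) * (t / n) ≤ n * (t / n) := by gcongr
      _ = t := by field_simp
  have hend : a + (n : ℝ≥0) * (t / n) = a + t := by
    congr 1
    rw [← NNReal.coe_inj]
    push_cast
    field_simp
  have hstart : a + ((0 : ℕ) : ℝ≥0) * (t / n) = a := by simp
  have key := exists_inFirstStay_and_return (D := D) (n := n)
    (z := fun k : ℕ => y (a + k * (t / n))) (by simpa using h0) (by simp only [hend, hstart, hb])
    ?_ ?_
  · simpa using key
  · -- the first grid point after `s`
    have hh : (0 : ℝ) < t / n := div_pos (by exact_mod_cast ht) hn0'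
    set l := ⌊((s : ℝ) - a) / (t / n)⌋₊ + 1 with hl
    have h1 : ((s : ℝ) - a) / (t / n) < l := by
      rw [hl]; push_cast; exact Nat.lt_floor_add_one _
    have h2 : (l : ℝ) ≤ ((s : ℝ) - a) / (t / n) + 1 := by
      rw [hl]; push_cast
      have := Nat.floor_le (div_nonneg (sub_nonneg.2 (NNReal.coe_le_coe.2 hs.1)) hh.le)
      linarith
    rw [div_lt_iff₀ hh] at h1
    have h2' : (l : ℝ) * (t / n) ≤ (s - a) + t / n := by
      calc (l : ℝ) * (t / n) ≤ (((s : ℝ) - a) / (t / n) + 1) * (t / n) := by gcongr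
        _ = _ := by field_simp
    have hn' : (t : ℝ) / n < min (v : ℝ) (a + t) - s := by
      have := NNReal.coe_lt_coe.2 hn
      rw [NNReal.coe_sub (lt_min hv hsb).le] at this
      simpa using this
    have hmv := min_le_left (v : ℝ) (a + t)
    have hmt := min_le_right (v : ℝ) (a + t)
    have hln : l ≤ n := by
      have : (l : ℝ) * (t / n) ≤ n * (t / n) := by
        have : (n : ℝ) * (t / n) = t := by field_simp
        linarith
      exact_mod_cast le_of_mul_le_mul_right this hh
    refine ⟨l, hln, hvD ⟨?_, ?_⟩⟩
    · rw [← NNReal.coe_lt_coe]; push_cast; linarith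
    · rw [← NNReal.coe_lt_coe]; push_cast; linarith
  · intro l hl
    simpa using hall _ (hgrid l hl)

end Paths

/-! ### Markov property and returns through shallow traps -/

/-- In a short time, the walk jumps from a site `j` to each of the other sites with about the same
probability. Hence, for `j ∉ B`, it jumps to a given site of `B` with a probability of about
`1 / card B` times that of jumping to `B`; the factor `2` absorbs the error. -/
lemma eventually_transition_le {x : ℕ → ℝ} (hx : ∀ i, 0 < x i) {N : ℕ} (hN : 1 ≤ N)
    (B : Finset (Fin N)) (hB : B.Nonempty) :
    ∀ᶠ h in 𝓝[>] (0 : ℝ), ∀ j ∉ B, ∀ i ∈ B,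
      transition x N h j i ≤ 2 / (B.card : ℝ) * ∑ l ∈ B, transition x N h j l := by
  have hN0 : (0 : ℝ) < N := by positivity
  have hm : (0 : ℝ) < B.card := by exact_mod_cast hB.card_pos
  refine eventually_all.2 fun j => ?_
  by_cases hj : j ∈ B
  · exact Eventually.of_forall fun h hj' => absurd hj hj'
  suffices ∀ᶠ h in 𝓝[>] (0 : ℝ), ∀ i, i ∈ B →
      transition x N h j i ≤ 2 / (B.card : ℝ) * ∑ l ∈ B, transition x N h j l from
    this.mono fun h hh _ => hh
  refine eventually_all.2 fun i => ?_
  by_cases hi : i ∈ B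
  swap
  · exact Eventually.of_forall fun h hi' => absurd hi' hi
  have hne : ∀ l ∈ B, j ≠ l := fun l hl e => hj (e ▸ hl)
  have hd : ∀ l ∈ B, HasDerivAt (fun s => transition x N s j l) (x j / N) 0 := fun l hl => by
    refine (hasDerivAt_transition x N j l 0).congr_deriv ?_
    simp only [transition_zero, Matrix.one_apply, ite_mul, one_mul, zero_mul, Finset.sum_ite_eq,
      Finset.mem_univ, if_true, generator_apply x hN, if_neg (hne l hl)]
    ring
  have hΦ := ((HasDerivAt.fun_sum hd).const_mul (2 / (B.card : ℝ))).sub (hd i hi)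
  have hlim := hΦ.tendsto_slope_zero_right
  have hpos : 0 < 2 / (B.card : ℝ) * ∑ l ∈ B, x j / (N : ℝ) - x j / N := by
    rw [Finset.sum_const, nsmul_eq_mul]
    have : 0 < x j / N := div_pos (hx j) hN0
    have e : 2 / (B.card : ℝ) * (B.card * (x j / N)) = 2 * (x j / N) := by field_simp
    rw [e]
    linarith
  filter_upwards [Tendsto.eventually_const_lt hpos hlim, self_mem_nhdsWithin] with h hh hh0 _
  have hh0 : 0 < h := hh0
  have h0 : ∀ l ∈ B, transition x N 0 j l = 0 := fun l hl => by
    rw [transition_zero, Matrix.one_apply_ne (hne l hl)]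
  simp only [zero_add, Pi.sub_apply, h0 i hi, Finset.sum_eq_zero h0, mul_zero, sub_zero,
    smul_eq_mul] at hh
  have := (pos_iff_pos_of_mul_pos hh).1 (inv_pos.2 hh0)
  linarith

section Markov

variable {x : ℕ → ℝ} {N : ℕ} {Ω' : Type*} [MeasurableSpace Ω'] {μ : Measure Ω'}
  {Y : ℝ≥0 → Ω' → Fin N}

lemma IsTrapWalk.measureReal_eq_occupation (hY : IsTrapWalk x N μ Y) (s : ℝ≥0) (j : Fin N) :
    μ.real {ω | Y s ω = j} = occupation x N s j := by
  have := hY.isProbabilityMeasure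
  have h1 := sum_measureReal_preimage_singleton (μ := μ.restrict {ω | Y s ω = j}) Finset.univ
    (f := Y 0) fun i _ => hY.measurable 0 (measurableSet_singleton i)
  rw [Finset.coe_univ, Set.preimage_univ, measureReal_restrict_apply MeasurableSet.univ,
    Set.univ_inter] at h1
  rw [← h1, occupation, Finset.mul_sum]
  refine Finset.sum_congr rfl fun i _ => ?_
  rw [measureReal_restrict_apply (hY.measurable 0 (measurableSet_singleton i))]
  have h2 := hY.fdd 1 (fun k => if k = 0 then 0 else s) (fun k => if k = 0 then i else j)
    (fun a b hab => by
      dsimp only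
      split_ifs with h1 h2
      · exact le_rfl
      · exact zero_le
      · omega
      · exact le_rfl) (by simp)
  simp only [Finset.range_one, Finset.prod_singleton, zero_add, one_ne_zero, if_false, if_true,
    NNReal.coe_zero, sub_zero] at h2
  rw [← h2]
  congr 1
  ext ω
  simp only [Set.mem_inter_iff, Set.mem_preimage, Set.mem_singleton_iff, Set.mem_ofPred_eq]
  constructor
  · rintro ⟨h3, h4⟩ k hk
    interval_cases k <;> simp [h3, h4]
  · intro h
    exact ⟨by simpa using h 0 (by norm_num), by simpa using h 1 le_rfl⟩

lemma IsTrapWalk.occupation_nonneg (hY : IsTrapWalk x N μ Y) (s : ℝ≥0) (j : Fin N) :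
    0 ≤ occupation x N s j := by
  rw [← hY.measureReal_eq_occupation]
  exact measureReal_nonneg

lemma IsTrapWalk.sum_occupation (hY : IsTrapWalk x N μ Y) (s : ℝ≥0) :
    ∑ j, occupation x N s j = 1 := by
  have := hY.isProbabilityMeasure
  have h1 := sum_measureReal_preimage_singleton (μ := μ) Finset.univ
    (f := Y s) fun i _ => hY.measurable s (measurableSet_singleton i)
  rw [Finset.coe_univ, Set.preimage_univ, probReal_univ] at h1
  rw [← h1]
  exact Finset.sum_congr rfl fun j _ => (hY.measureReal_eq_occupation s j).symm

lemma IsTrapWalk.measurableSet_of_finite_dep (hY : IsTrapWalk x N μ Y) (t : ℕ → ℝ≥0) (n : ℕ)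
    {G : (ℕ → Fin N) → Prop} (hG : ∀ z z', (∀ k ≤ n, z k = z' k) → G z → G z') :
    MeasurableSet {ω | G fun k => Y (t k) ω} := by
  have hf : Measurable fun ω (k : Fin (n + 1)) => Y (t k) ω :=
    measurable_pi_lambda _ fun k => hY.measurable (t k)
  have := hf (Set.toFinite
    {p : Fin (n + 1) → Fin N | G fun k => p ⟨min k n, by omega⟩}).measurableSet
  convert this using 1
  ext ω
  constructor
  · exact hG _ _ fun k hk => by simp [min_eq_left hk]
  · exact hG _ _ fun k hk => by simp [min_eq_left hk]

/-- The Markov property, on the event that the positions up to the step `n` are `i`. -/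
lemma IsTrapWalk.measureReal_cylinder_and (hY : IsTrapWalk x N μ Y) {t : ℕ → ℝ≥0}
    (ht : Monotone t) (ht0 : t 0 = 0) (n : ℕ) (i : ℕ → Fin N) (B : Finset (Fin N)) :
    μ.real {ω | (∀ k ≤ n, Y (t k) ω = i k) ∧ Y (t (n + 1)) ω ∈ B} =
      μ.real {ω | ∀ k ≤ n, Y (t k) ω = i k} *
        ∑ j ∈ B, transition x N ((t (n + 1) : ℝ) - t n) (i n) j := by
  have := hY.isProbabilityMeasure
  have h1 := sum_measureReal_preimage_singleton
    (μ := μ.restrict {ω | ∀ k ≤ n, Y (t k) ω = i k}) B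
    (f := Y (t (n + 1))) fun j _ => hY.measurable _ (measurableSet_singleton j)
  rw [measureReal_restrict_apply (hY.measurable _ B.measurableSet)] at h1
  rw [show {ω | (∀ k ≤ n, Y (t k) ω = i k) ∧ Y (t (n + 1)) ω ∈ B} =
    Y (t (n + 1)) ⁻¹' ↑B ∩ {ω | ∀ k ≤ n, Y (t k) ω = i k} from Set.ext fun ω => and_comm, ← h1,
    Finset.mul_sum]
  refine Finset.sum_congr rfl fun j _ => ?_
  rw [measureReal_restrict_apply (hY.measurable _ (measurableSet_singleton j))]
  have h2 := hY.fdd (n + 1) t (Function.update i (n + 1) j) ht ht0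
  rw [Finset.prod_range_succ, Function.update_self, Function.update_of_ne (by omega : n ≠ n + 1),
    ← mul_assoc, Finset.prod_congr rfl fun k hk => by
      have := Finset.mem_range.1 hk
      rw [Function.update_of_ne (by omega : k ≠ n + 1),
        Function.update_of_ne (by omega : k + 1 ≠ n + 1)], ← hY.fdd n t i ht ht0] at h2
  rw [← h2]
  congr 1
  ext ω
  simp only [Set.mem_inter_iff, Set.mem_preimage, Set.mem_singleton_iff, Set.mem_ofPred_eq]
  constructor
  · rintro ⟨h3, h4⟩ k hk
    rcases Nat.le_succ_iff.1 hk with h | h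
    · rw [Function.update_of_ne (by omega), h4 k h]
    · subst h
      rw [Function.update_self, h3]
  · intro h
    refine ⟨by simpa using h (n + 1) le_rfl, fun k hk => ?_⟩
    rw [h k (by omega), Function.update_of_ne (by omega)]

/-- Transition probabilities from the current site to a site `a` and to a set `B` which compare
on the event `G` of the past also compare after integration over `G`. -/
lemma IsTrapWalk.measureReal_next_le (hY : IsTrapWalk x N μ Y) {t : ℕ → ℝ≥0}
    (ht : Monotone t) (ht0 : t 0 = 0) (n : ℕ) {G : (ℕ → Fin N) → Prop}
    (hG : ∀ z z', (∀ k ≤ n, z k = z' k) → G z → G z') {a : (ℕ → Fin N) → Fin N}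
    (ha : ∀ z z', (∀ k ≤ n, z k = z' k) → a z = a z') (B : Finset (Fin N)) (c : ℝ)
    (hc : ∀ z, G z → transition x N ((t (n + 1) : ℝ) - t n) (z n) (a z) ≤
      c * ∑ j ∈ B, transition x N ((t (n + 1) : ℝ) - t n) (z n) j) :
    μ.real {ω | G (fun k => Y (t k) ω) ∧ Y (t (n + 1)) ω = a fun k => Y (t k) ω} ≤
      c * μ.real {ω | G (fun k => Y (t k) ω) ∧ Y (t (n + 1)) ω ∈ B} := by
  have := hY.isProbabilityMeasure
  have hf : Measurable fun ω (k : Fin (n + 1)) => Y (t k) ω :=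
    measurable_pi_lambda _ fun k => hY.measurable (t k)
  have key : ∀ E : Set Ω', μ.real E =
      ∑ p : Fin (n + 1) → Fin N, μ.real ((fun ω (k : Fin (n + 1)) => Y (t k) ω) ⁻¹' {p} ∩ E) := by
    intro E
    have h1 := sum_measureReal_preimage_singleton (μ := μ.restrict E) Finset.univ
      (f := fun ω (k : Fin (n + 1)) => Y (t k) ω) fun p _ => hf (measurableSet_singleton p)
    rw [Finset.coe_univ, Set.preimage_univ, measureReal_restrict_apply MeasurableSet.univ,
      Set.univ_inter] at h1
    rw [← h1]
    exact Finset.sum_congr rfl fun p _ =>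
      measureReal_restrict_apply (hf (measurableSet_singleton p))
  rw [key {ω | G (fun k => Y (t k) ω) ∧ Y (t (n + 1)) ω = a fun k => Y (t k) ω},
    key {ω | G (fun k => Y (t k) ω) ∧ Y (t (n + 1)) ω ∈ B}, Finset.mul_sum]
  refine Finset.sum_le_sum fun p _ => ?_
  set z : ℕ → Fin N := fun k => p ⟨min k n, by omega⟩ with hz
  have hp : ∀ ω, (fun k : Fin (n + 1) => Y (t k) ω) = p ↔ ∀ k ≤ n, Y (t k) ω = z k := by
    intro ω
    constructor
    · rintro rfl k hk
      simp [hz, min_eq_left hk]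
    · intro h
      funext k
      have hk : (k : ℕ) ≤ n := Nat.lt_succ_iff.1 k.2
      rw [h k hk]
      simp [hz, min_eq_left hk]
  by_cases hGz : G z
  · have e1 : (fun ω (k : Fin (n + 1)) => Y (t k) ω) ⁻¹' {p} ∩
        {ω | G (fun k => Y (t k) ω) ∧ Y (t (n + 1)) ω = a fun k => Y (t k) ω} =
        {ω | (∀ k ≤ n, Y (t k) ω = z k) ∧ Y (t (n + 1)) ω ∈ ({a z} : Finset (Fin N))} := by
      ext ω
      simp only [Set.mem_inter_iff, Set.mem_preimage, Set.mem_singleton_iff, Set.mem_ofPred_eq,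
        hp, Finset.mem_singleton]
      refine and_congr_right fun h => ?_
      rw [ha _ z h]
      exact and_iff_right (hG z _ (fun k hk => (h k hk).symm) hGz)
    have e2 : (fun ω (k : Fin (n + 1)) => Y (t k) ω) ⁻¹' {p} ∩
        {ω | G (fun k => Y (t k) ω) ∧ Y (t (n + 1)) ω ∈ B} =
        {ω | (∀ k ≤ n, Y (t k) ω = z k) ∧ Y (t (n + 1)) ω ∈ B} := by
      ext ω
      simp only [Set.mem_inter_iff, Set.mem_preimage, Set.mem_singleton_iff, Set.mem_ofPred_eq, hp]
      refine and_congr_right fun h => ?_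
      exact and_iff_right (hG z _ (fun k hk => (h k hk).symm) hGz)
    rw [e1, e2, hY.measureReal_cylinder_and ht ht0, hY.measureReal_cylinder_and ht ht0,
      Finset.sum_singleton, mul_left_comm]
    exact mul_le_mul_of_nonneg_left (hc z hGz) measureReal_nonneg
  · have e : ∀ Q : Set Ω', (fun ω (k : Fin (n + 1)) => Y (t k) ω) ⁻¹' {p} ∩
        {ω | G (fun k => Y (t k) ω) ∧ ω ∈ Q} = ∅ := by
      intro Q
      ext ω
      simp only [Set.mem_inter_iff, Set.mem_preimage, Set.mem_singleton_iff, Set.mem_ofPred_eq,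
        hp, Set.mem_empty_iff_false, iff_false]
      rintro ⟨h, h', -⟩
      exact hGz (hG _ _ h h')
    have e1 := e {ω | Y (t (n + 1)) ω = a fun k => Y (t k) ω}
    have e2 := e {ω | Y (t (n + 1)) ω ∈ B}
    simp only [Set.mem_ofPred_eq] at e1 e2
    rw [e1, e2]
    simp

/-- When the first stay in `D` of the walk on a grid ends, the walk is back at its starting point
with a conditional probability of at most `c`. -/
lemma IsTrapWalk.measureReal_grid_return_le (hY : IsTrapWalk x N μ Y) (D : Set (Fin N))
    (B : Finset (Fin N)) (hB : ∀ i, i ∈ B ↔ i ∉ D) (a h : ℝ≥0) {c : ℝ} (hc0 : 0 ≤ c)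
    (hc : ∀ j ∉ B, ∀ i ∈ B, transition x N h j i ≤ c * ∑ l ∈ B, transition x N h j l) (n : ℕ) :
    μ.real {ω | ∃ k < n, InFirstStay D k (fun l => Y (a + l * h) ω) ∧
      Y (a + (k + 1 : ℕ) * h) ω = Y a ω} ≤ c := by
  have := hY.isProbabilityMeasure
  -- the distributions are given along sequences of times which start at `0`
  set t : ℕ → ℝ≥0 := fun k => if k = 0 then 0 else a + (k - 1 : ℕ) * h with ht
  have ht0 : t 0 = 0 := by simp [ht]
  have hts : ∀ k, t (k + 1) = a + k * h := fun k => by simp [ht]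
  have htm : Monotone t := by
    refine monotone_nat_of_le_succ fun k => ?_
    rcases k with _ | k
    · rw [ht0]; exact zero_le
    · rw [hts, hts]
      gcongr
      simp
  have hstep : ∀ k, ((t (k + 1 + 1) : ℝ≥0) : ℝ) - t (k + 1) = h := fun k => by
    rw [hts, hts]; push_cast; ring
  set G : ℕ → (ℕ → Fin N) → Prop := fun k w => InFirstStay D k fun l => w (l + 1) with hGdef
  have hG : ∀ k z z', (∀ l ≤ k + 1, z l = z' l) → G k z → G k z' := fun k z z' hzz hz =>
    hz.congr fun l hl => hzz (l + 1) (by omega)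
  have hle : ∀ k, μ.real {ω | G k (fun l => Y (t l) ω) ∧ Y (t (k + 1 + 1)) ω = Y (t 1) ω} ≤
      c * μ.real {ω | G k (fun l => Y (t l) ω) ∧ Y (t (k + 1 + 1)) ω ∈ B} := fun k => by
    refine hY.measureReal_next_le htm ht0 (k + 1) (hG k) (a := fun z => z 1)
      (fun z z' hzz => hzz 1 (by omega)) B c fun z hz => ?_
    rw [hstep]
    obtain ⟨h0, m, hm, -, h2⟩ := hz
    exact hc _ (fun hmem => (hB _).1 hmem (h2 k hm le_rfl)) _ ((hB _).2 h0)
  have hmeas : ∀ k, MeasurableSet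
      {ω | G k (fun l => Y (t l) ω) ∧ Y (t (k + 1 + 1)) ω ∈ B} := fun k => by
    refine hY.measurableSet_of_finite_dep t (k + 1 + 1) (G := fun z => G k z ∧ z (k + 1 + 1) ∈ B)
      fun z z' hzz hz => ⟨hG k z z' (fun l hl => hzz l (by omega)) hz.1, ?_⟩
    rw [← hzz _ le_rfl]
    exact hz.2
  have hdisj : ∀ k k' ω, (G k (fun l => Y (t l) ω) ∧ Y (t (k + 1 + 1)) ω ∈ B) →
      (G k' (fun l => Y (t l) ω) ∧ Y (t (k' + 1 + 1)) ω ∈ B) → k' ≤ k := fun k k' ω hk hk' =>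
    hk.1.le_of_notMem ((hB _).1 hk.2) hk'.1
  have hsum : ∑ k ∈ Finset.range n,
      μ.real {ω | G k (fun l => Y (t l) ω) ∧ Y (t (k + 1 + 1)) ω ∈ B} ≤ 1 := by
    rw [← measureReal_biUnion_finset (fun k _ k' _ hkk => ?_) fun k _ => hmeas k]
    · exact measureReal_le_one
    · refine Set.disjoint_left.2 fun ω hk hk' => hkk ?_
      exact le_antisymm (hdisj k' k ω hk' hk) (hdisj k k' ω hk hk')
  calc _ ≤ μ.real (⋃ k ∈ Finset.range n,
        {ω | G k (fun l => Y (t l) ω) ∧ Y (t (k + 1 + 1)) ω = Y (t 1) ω}) := by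
        refine measureReal_mono ?_ (measure_ne_top _ _)
        rintro ω ⟨k, hk, h1, h2⟩
        refine Set.mem_biUnion (Finset.mem_coe.2 (Finset.mem_range.2 hk)) ⟨?_, ?_⟩
        · simp only [hGdef, hts]
          exact h1
        · rw [hts, hts 0, h2]
          simp
    _ ≤ _ := measureReal_biUnion_finset_le _ _
    _ ≤ _ := Finset.sum_le_sum fun k _ => hle k
    _ ≤ c * 1 := by rw [← Finset.mul_sum]; exact mul_le_mul_of_nonneg_left hsum hc0
    _ = c := mul_one c

/-- Fatou's lemma for sets, without measurability. -/
lemma measureReal_le_of_ae_eventually_mem {Ω : Type*} [MeasurableSpace Ω] {P : Measure Ω}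
    [IsFiniteMeasure P] {S : Set Ω} {U : ℕ → Set Ω} {c : ℝ} (hc0 : 0 ≤ c)
    (hS : ∀ᵐ ω ∂P, ω ∈ S → ∀ᶠ n in atTop, ω ∈ U n) (hU : ∀ᶠ n in atTop, P.real (U n) ≤ c) :
    P.real S ≤ c := by
  have h1 : P S ≤ P (⋃ n, ⋂ m ≥ n, U m) := by
    refine measure_mono_ae ?_
    filter_upwards [hS] with ω hω hmem
    obtain ⟨n, hn⟩ := eventually_atTop.1 (hω hmem)
    exact Set.mem_iUnion.2 ⟨n, Set.mem_iInter₂.2 hn⟩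
  have hmono : Monotone fun n => ⋂ m ≥ n, U m := fun n n' hnn =>
    Set.biInter_subset_biInter_left fun m hm => le_trans hnn hm
  rw [hmono.measure_iUnion] at h1
  refine ENNReal.toReal_le_of_le_ofReal hc0 (h1.trans (iSup_le fun n => ?_))
  obtain ⟨m, hm, hnm⟩ := (hU.and (eventually_ge_atTop n)).exists
  refine (measure_mono (Set.biInter_subset_of_mem (show m ∈ {k | k ≥ n} from hnm))).trans ?_
  rw [← ofReal_measureReal]
  exact ENNReal.ofReal_le_ofReal hm

/-- The walk is unlikely to find its way back to its site through `D` only, if there are many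
sites outside `D`: on leaving `D` it is about as likely to hit any of them. -/
lemma IsTrapWalk.measureReal_returnsThrough_le (hx : ∀ i, 0 < x i) (hN : 1 ≤ N)
    (hY : IsTrapWalk x N μ Y) (D : Set (Fin N)) (B : Finset (Fin N)) (hB : ∀ i, i ∈ B ↔ i ∉ D)
    (hne : B.Nonempty) (a t : ℝ≥0) :
    μ.real {ω | ReturnsThrough (fun s => Y s ω) D a (a + t)} ≤ 2 / B.card := by
  have := hY.isProbabilityMeasure
  rcases eq_or_ne t 0 with rfl | ht
  · have : {ω | ReturnsThrough (fun s => Y s ω) D a (a + 0)} = ∅ := by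
      ext ω
      simp only [Set.mem_ofPred_eq, Set.mem_empty_iff_false, iff_false]
      rintro ⟨h0, -, ⟨s, hs, hsD⟩, -⟩
      rw [add_zero] at hs
      rw [le_antisymm hs.2 hs.1] at hsD
      exact h0 hsD
    rw [this]
    simp only [measureReal_empty]
    positivity
  have ht : (0 : ℝ) < t := by exact_mod_cast pos_iff_ne_zero.2 ht
  refine measureReal_le_of_ae_eventually_mem (by positivity)
    (U := fun n => {ω | ∃ k < n, InFirstStay D k (fun l => Y (a + l * (t / n)) ω) ∧
      Y (a + (k + 1 : ℕ) * (t / n)) ω = Y a ω}) ?_ ?_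
  · filter_upwards [hY.cadlag] with ω hω hret
    exact hret.eventually_exists_inFirstStay hω
  · have hlim : Tendsto (fun n : ℕ => (t : ℝ) / n) atTop (𝓝[>] 0) := by
      refine tendsto_nhdsWithin_iff.2 ⟨tendsto_const_div_atTop_nhds_zero_nat _, ?_⟩
      filter_upwards [eventually_gt_atTop 0] with n hn
      exact div_pos ht (by exact_mod_cast hn)
    filter_upwards [hlim.eventually (eventually_transition_le hx hN B hne)] with n hn
    refine hY.measureReal_grid_return_le D B hB a (t / n) (by positivity) ?_ n
    push_cast
    exact hn

end Markov

/-! ### The landscape -/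

instance nullSingletonClass_expMeasure (α : ℝ) : NullSingletonClass (expMeasure α) :=
  inferInstanceAs (NullSingletonClass (volume.withDensity (gammaPDF 1 α)))

/-- On `[0, K]` the density `α exp (-α y)` times `exp y` is at least `α`. This is where `α < 1`
enters: the mean waiting time has an infinite mean. -/
lemma le_integral_min_exp {α : ℝ} (hα₀ : 0 < α) (hα₁ : α < 1) (K : ℝ) :
    α * K ≤ ∫ y, min (Real.exp K) (Real.exp y) ∂(expMeasure α) := by
  have := isProbabilityMeasure_expMeasure hα₀
  have hmeas : Measurable fun y => min (Real.exp K) (Real.exp y) := by fun_prop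
  have hint : Integrable (fun y => min (Real.exp K) (Real.exp y)) (expMeasure α) := by
    refine Integrable.of_bound hmeas.aestronglyMeasurable (Real.exp K)
      (Eventually.of_forall fun y => ?_)
    rw [Real.norm_of_nonneg (by positivity)]
    exact min_le_left _ _
  refine (ENNReal.ofReal_le_ofReal_iff (integral_nonneg fun y => by positivity)).1 ?_
  rw [ofReal_integral_eq_lintegral_ofReal hint (Eventually.of_forall fun y => by positivity)]
  have hpdf : Measurable (exponentialPDF α) := measurable_exponentialPDFReal α |>.ennreal_ofReal
  change _ ≤ ∫⁻ y, _ ∂(volume.withDensity (exponentialPDF α))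
  rw [lintegral_withDensity_eq_lintegral_mul _ hpdf hmeas.ennreal_ofReal]
  calc ENNReal.ofReal (α * K) = ∫⁻ y in Set.Icc 0 K, ENNReal.ofReal α := by
        rw [setLIntegral_const, Real.volume_Icc, sub_zero, ENNReal.ofReal_mul hα₀.le]
    _ ≤ ∫⁻ y in Set.Icc 0 K, (exponentialPDF α *
          fun y => ENNReal.ofReal (min (Real.exp K) (Real.exp y))) y := by
        refine setLIntegral_mono' measurableSet_Icc fun y hy => ?_
        rw [Pi.mul_apply, exponentialPDF_eq, if_pos hy.1, min_eq_right (Real.exp_le_exp.2 hy.2),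
          ← ENNReal.ofReal_mul (by positivity), mul_assoc, ← Real.exp_add]
        refine ENNReal.ofReal_le_ofReal (le_mul_of_one_le_right hα₀.le (Real.one_le_exp ?_))
        nlinarith [hy.1]
    _ ≤ _ := setLIntegral_le_lintegral _ _

section Landscape

variable {Ω : Type*} [MeasurableSpace Ω] {P : Measure Ω} [IsProbabilityMeasure P] {α : ℝ}
  {E : ℕ → Ω → ℝ}

lemma IsLandscape.ae_injective_rates (hE : IsLandscape P α E) :
    ∀ᵐ ω ∂P, Function.Injective (rates fun i => E i ω) := by
  have h : ∀ i j, i ≠ j → ∀ᵐ ω ∂P, E i ω ≠ E j ω := by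
    intro i j hij
    have hi := hE.law i
    have hj := hE.law j
    have hprod := (indepFun_iff_map_prod_eq_prod_map_map hi.aemeasurable hj.aemeasurable).1
      (hE.indep.indepFun hij)
    have hs : MeasurableSet {p : ℝ × ℝ | p.1 = p.2} := measurableSet_diagonal
    have hfin : IsProbabilityMeasure (Measure.map (E j) P) :=
      Measure.isProbabilityMeasure_map hj.aemeasurable
    have h0 : Measure.map (fun ω => (E i ω, E j ω)) P {p : ℝ × ℝ | p.1 = p.2} = 0 := by
      rw [hprod, Measure.measure_prod_null hs]
      refine Eventually.of_forall fun a => ?_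
      have : Prod.mk a ⁻¹' {p : ℝ × ℝ | p.1 = p.2} = {a} := by
        ext b; simp [eq_comm]
      change Measure.map (E j) P _ = 0
      rw [this, hj.map_eq]
      exact measure_singleton a
    rw [Measure.map_apply_of_aemeasurable (hi.aemeasurable.prodMk hj.aemeasurable) hs] at h0
    exact measure_eq_zero_iff_ae_notMem.1 h0
  have h' : ∀ᵐ ω ∂P, ∀ i j, i ≠ j → E i ω ≠ E j ω := by
    simp only [ae_all_iff]
    exact h
  filter_upwards [h'] with ω hω i j hij
  by_contra hne
  exact hω i j hne (neg_injective (Real.exp_injective hij))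

/-- The law of large numbers for the truncated mean waiting times. -/
lemma IsLandscape.ae_eventually_le_average (hα₀ : 0 < α) (hα₁ : α < 1)
    (hE : IsLandscape P α E) :
    ∀ᵐ ω ∂P, ∀ C : ℝ, ∃ k : ℝ, 0 ≤ k ∧ ∀ᶠ N : ℕ in atTop,
      C ≤ (∑ j ∈ Finset.range N, min k (rates (fun i => E i ω) j)⁻¹) / N := by
  have h : ∀ n : ℕ, ∀ᵐ ω ∂P, Tendsto (fun N : ℕ => (∑ j ∈ Finset.range N,
      min (Real.exp n) (Real.exp (E j ω))) / N) atTop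
        (𝓝 (∫ ω, min (Real.exp n) (Real.exp (E 0 ω)) ∂P)) := by
    intro n
    have hmeas : Measurable fun y => min (Real.exp n) (Real.exp y) := by fun_prop
    refine strong_law_ae_real (fun j ω => min (Real.exp n) (Real.exp (E j ω))) ?_ ?_ ?_
    · refine Integrable.of_bound
        (hmeas.comp_aemeasurable (hE.law 0).aemeasurable).aestronglyMeasurable (Real.exp n)
        (Eventually.of_forall fun y => ?_)
      rw [Real.norm_of_nonneg (by positivity)]
      exact min_le_left _ _
    · intro i j hij
      exact (hE.indep.indepFun hij).comp hmeas hmeas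
    · exact fun i => ((hE.law i).identDistrib (hE.law 0)).comp hmeas
  filter_upwards [ae_all_iff.2 h] with ω hω C
  obtain ⟨n, hn⟩ := exists_nat_gt (C / α)
  refine ⟨Real.exp n, (Real.exp_pos _).le, ?_⟩
  have hlt : C < ∫ ω, min (Real.exp n) (Real.exp (E 0 ω)) ∂P := by
    have hmeas : Measurable fun y => min (Real.exp n) (Real.exp y) := by fun_prop
    rw [← integral_map (φ := E 0) (f := fun y => min (Real.exp n) (Real.exp y))
      (hE.law 0).aemeasurable hmeas.aestronglyMeasurable, (hE.law 0).map_eq]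
    refine lt_of_lt_of_le ?_ (le_integral_min_exp hα₀ hα₁ n)
    rw [div_lt_iff₀ hα₀] at hn
    linarith
  filter_upwards [Tendsto.eventually_const_lt hlt (hω n)] with N hN
  simpa [rates, Real.exp_neg] using hN.le

end Landscape

/-- If the averages of the truncated mean waiting times get arbitrarily large, then there are
infinitely many deep traps. -/
lemma tendsto_card_deep {x : ℕ → ℝ} {δ : ℝ} (hδ : 0 < δ)
    (h : ∀ C : ℝ, ∃ k : ℝ, 0 ≤ k ∧ ∀ᶠ N : ℕ in atTop,
      C ≤ (∑ j ∈ Finset.range N, min k (x j)⁻¹) / N) :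
    Tendsto (fun N => ((Finset.range N).filter fun j => x j < δ).card) atTop atTop := by
  refine tendsto_atTop_atTop_of_monotone
    (fun a b hab => Finset.card_le_card (Finset.filter_subset_filter _
      (Finset.range_subset_range.2 hab))) fun M => ?_
  obtain ⟨k, hk, hev⟩ := h (δ⁻¹ + 1)
  -- with at most `M` deep traps the average would be at most `δ⁻¹ + k * M / N`
  obtain ⟨n, hn⟩ := exists_nat_gt (k * M)
  obtain ⟨N, hN, hNn⟩ := (hev.and (eventually_ge_atTop (n + 1))).exists
  refine ⟨N, ?_⟩
  by_contra! hlt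
  have hN0 : (0 : ℝ) < N := by
    have : 0 < N := by omega
    exact_mod_cast this
  have hsum : ∑ j ∈ Finset.range N, min k (x j)⁻¹ ≤
      ∑ j ∈ Finset.range N, (δ⁻¹ + if x j < δ then k else 0) := by
    refine Finset.sum_le_sum fun j _ => ?_
    split_ifs with hj
    · have := min_le_left k (x j)⁻¹
      have := inv_pos.2 hδ
      linarith
    · rw [add_zero]
      exact (min_le_right _ _).trans (inv_anti₀ hδ (not_lt.1 hj))
  rw [Finset.sum_add_distrib, Finset.sum_const, Finset.card_range, nsmul_eq_mul,
    ← Finset.sum_filter, Finset.sum_const, nsmul_eq_mul] at hsum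
  rw [le_div_iff₀ hN0] at hN
  have hcard : (((Finset.range N).filter fun j => x j < δ).card : ℝ) * k ≤ k * M := by
    rw [mul_comm]
    gcongr
  have : (n : ℝ) + 1 ≤ N := by exact_mod_cast hNn
  nlinarith

/-! ### Comparison of the correlation functions and limits -/

section Bounds

variable {x : ℕ → ℝ} {N : ℕ} {Ω' : Type*} [MeasurableSpace Ω'] {μ : Measure Ω'}
  {Y : ℝ≥0 → Ω' → Fin N} {δ : ℝ}

lemma abs_measureReal_sub_le [IsFiniteMeasure μ] {A A' Z : Set Ω'} (h1 : A ⊆ A')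
    (h2 : ∀ᵐ ω ∂μ, ω ∈ A' → ω ∈ A ∨ ω ∈ Z) : |μ.real A' - μ.real A| ≤ μ.real Z := by
  have h3 : μ.real A' ≤ μ.real (A ∪ Z) :=
    ENNReal.toReal_mono (measure_ne_top _ _) (measure_mono_ae h2)
  have h4 := measureReal_union_le (μ := μ) A Z
  rw [abs_of_nonneg (sub_nonneg.2 (measureReal_mono h1))]
  linarith

lemma IsTrapWalk.meanRate_nonneg (hx : ∀ i, 0 < x i) (hY : IsTrapWalk x N μ Y) (s : ℝ≥0) :
    0 ≤ meanRate x N s :=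
  Finset.sum_nonneg fun j _ => mul_nonneg (hx j).le (hY.occupation_nonneg s j)

/-- Markov's inequality for the rate `x_N(s)`. -/
lemma IsTrapWalk.measureReal_shallow_le (hx : ∀ i, 0 < x i) (hδ : 0 < δ)
    (hY : IsTrapWalk x N μ Y) (s : ℝ≥0) :
    μ.real {ω | Y s ω ∈ shallow x δ N} ≤ meanRate x N s / δ := by
  classical
  have := hY.isProbabilityMeasure
  set S : Finset (Fin N) := Finset.univ.filter fun i => δ ≤ x i with hS
  have h1 := sum_measureReal_preimage_singleton (μ := μ) S
    (f := Y s) fun i _ => hY.measurable s (measurableSet_singleton i)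
  have e : {ω | Y s ω ∈ shallow x δ N} = Y s ⁻¹' ↑S := by
    ext ω
    simp [hS, shallow]
  rw [e, ← h1, le_div_iff₀ hδ, Finset.sum_mul]
  calc ∑ i ∈ S, μ.real (Y s ⁻¹' {i}) * δ ≤ ∑ i ∈ S, x i * occupation x N s i := by
        refine Finset.sum_le_sum fun i hi => ?_
        rw [← hY.measureReal_eq_occupation, mul_comm]
        exact mul_le_mul_of_nonneg_right (Finset.mem_filter.1 hi).2 measureReal_nonneg
    _ ≤ _ := Finset.sum_le_sum_of_subset_of_nonneg (Finset.subset_univ _) fun i _ _ =>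
        mul_nonneg (hx i).le (hY.occupation_nonneg s i)

lemma IsTrapWalk.measureReal_shallow_add_le (hx : ∀ i, 0 < x i) (hδ : 0 < δ) (hN : 1 ≤ N)
    (hY : IsTrapWalk x N μ Y) (t tw : ℝ≥0) :
    μ.real {ω | Y (tw + t) ω ∈ shallow x δ N} ≤ meanRate x N tw / δ := by
  refine (hY.measureReal_shallow_le hx hδ _).trans ?_
  gcongr
  exact antitone_meanRate x hN (by simp)

lemma IsTrapWalk.abs_corr₁_sub_corr_le (hx : ∀ i, 0 < x i) (hδ : 0 < δ) (hN : 1 ≤ N)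
    (hY : IsTrapWalk x N μ Y) (t tw : ℝ≥0) :
    |corr₁ x δ μ Y t tw - corr μ Y t tw| ≤ meanRate x N tw / δ := by
  have := hY.isProbabilityMeasure
  refine (abs_measureReal_sub_le ?_ ?_).trans (hY.measureReal_shallow_add_le hx hδ hN t tw)
  · rintro ω hω u hu ⟨i, hi, hne⟩
    exact absurd (not_jump_of_const hω hu hi) hne
  · filter_upwards [hY.cadlag] with ω hω h
    exact hω.const_or_mem_of_jumps le_self_add h

lemma IsTrapWalk.abs_corr₂_sub_corr_le (hx : ∀ i, 0 < x i) (hinj : Function.Injective x)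
    (hδ : 0 < δ) (hN : 1 ≤ N) (hY : IsTrapWalk x N μ Y) (B : Finset (Fin N))
    (hB : ∀ i, i ∈ B ↔ i ∉ shallow x δ N) (hne : B.Nonempty) (t tw : ℝ≥0) :
    |corr₂ x δ μ Y t tw - corr μ Y t tw| ≤ meanRate x N tw / δ + 2 / B.card := by
  have := hY.isProbabilityMeasure
  refine (abs_measureReal_sub_le (Z := {ω | Y (tw + t) ω ∈ shallow x δ N} ∪
    {ω | ReturnsThrough (fun s => Y s ω) (shallow x δ N) tw (tw + t)}) ?_ ?_).trans
    ((measureReal_union_le _ _).trans (add_le_add (hY.measureReal_shallow_add_le hx hδ hN t tw)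
      (hY.measureReal_returnsThrough_le hx hN _ B hB hne tw t)))
  · rintro ω hω u hu ⟨i, hi, hne⟩
    exact absurd (congrArg (fun j : Fin N => x j) (not_jump_of_const hω hu hi)) hne
  · filter_upwards [hY.cadlag] with ω hω h
    refine hω.const_or_mem_or_returnsThrough le_self_add fun u hu hj => h u hu ?_
    obtain ⟨i, hi, hne⟩ := hj
    exact ⟨i, hi, fun e => hne (Fin.val_injective (hinj e))⟩

end Bounds

section Limits

variable {A B : ℕ → ℝ≥0 → ℝ≥0 → ℝ}

lemma asympEqual_of_forall_eventually (h : ∀ ε > 0, ∀ᶠ tw in atTop, ∀ᶠ N in atTop,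
    ∀ t, |A N t tw - B N t tw| ≤ ε) : AsympEqual A B := by
  refine Metric.tendsto_nhds.2 fun ε hε => ?_
  filter_upwards [h (ε / 2) (half_pos hε)] with tw htw
  have hsup : ∀ᶠ N in atTop, ⨆ t : ℝ≥0, |A N t tw - B N t tw| ≤ ε / 2 :=
    htw.mono fun N hN => ciSup_le hN
  have hnn : ∀ N, 0 ≤ ⨆ t : ℝ≥0, |A N t tw - B N t tw| := fun N =>
    Real.iSup_nonneg fun t => abs_nonneg _
  have h1 : limsup (fun N => ⨆ t : ℝ≥0, |A N t tw - B N t tw|) atTop ≤ ε / 2 :=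
    limsup_le_of_le (isCoboundedUnder_le_of_le atTop hnn) hsup
  have h2 : 0 ≤ limsup (fun N => ⨆ t : ℝ≥0, |A N t tw - B N t tw|) atTop :=
    le_limsup_of_frequently_le (Frequently.of_forall hnn) ⟨_, hsup⟩
  rw [Real.dist_0_eq_abs, abs_of_nonneg h2]
  linarith

lemma AsympEqual.symm (h : AsympEqual A B) : AsympEqual B A := by
  unfold AsympEqual at h ⊢
  simpa only [abs_sub_comm] using h

lemma AgesTo.congr (hA : ∀ᶠ N in atTop, ∀ t tw, |A N t tw| ≤ 1)
    (hB : ∀ᶠ N in atTop, ∀ t tw, |B N t tw| ≤ 1) (h : AsympEqual A B) {θ : ℝ≥0} {ℓ : ℝ}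
    (hBθ : AgesTo B θ ℓ) : AgesTo A θ ℓ := by
  have hsum := Tendsto.add hBθ h
  rw [add_zero] at hsum
  have hdiff : ∀ᶠ N in atTop, ∀ t tw, |A N t tw - B N t tw| ≤ 2 := by
    filter_upwards [hA, hB] with N h1 h2 t tw
    have := abs_sub (A N t tw) (B N t tw)
    linarith [h1 t tw, h2 t tw]
  have hbdA : ∀ tw, IsBoundedUnder (· ≤ ·) atTop fun N => |A N (θ * tw) tw - ℓ| := fun tw =>
    ⟨1 + |ℓ|, by
      rw [eventually_map]
      filter_upwards [hA] with N h1
      have := abs_sub (A N (θ * tw) tw) ℓ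
      linarith [h1 (θ * tw) tw]⟩
  have hbdB : ∀ tw, IsBoundedUnder (· ≤ ·) atTop fun N => |B N (θ * tw) tw - ℓ| := fun tw =>
    ⟨1 + |ℓ|, by
      rw [eventually_map]
      filter_upwards [hB] with N h1
      have := abs_sub (B N (θ * tw) tw) ℓ
      linarith [h1 (θ * tw) tw]⟩
  have hbdS : ∀ tw, IsBoundedUnder (· ≤ ·) atTop
      fun N => ⨆ t : ℝ≥0, |A N t tw - B N t tw| := fun tw =>
    ⟨2, by
      rw [eventually_map]
      filter_upwards [hdiff] with N h1
      exact ciSup_le fun t => h1 t tw⟩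
  refine tendsto_of_tendsto_of_tendsto_of_le_of_le tendsto_const_nhds hsum
    (fun tw => le_limsup_of_frequently_le (Frequently.of_forall fun N => abs_nonneg _) (hbdA tw))
    fun tw => ?_
  have hnnB : ∀ N, 0 ≤ |B N (θ * tw) tw - ℓ| := fun N => abs_nonneg _
  have hnnS : ∀ N, 0 ≤ ⨆ t : ℝ≥0, |A N t tw - B N t tw| := fun N =>
    Real.iSup_nonneg fun t => abs_nonneg _
  refine le_trans (limsup_le_limsup (v := fun N => |B N (θ * tw) tw - ℓ| +
    ⨆ t : ℝ≥0, |A N t tw - B N t tw|) ?_ ?_ ?_) (limsup_add_le ?_ (hbdB tw) ?_ (hbdS tw))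
  · filter_upwards [hdiff] with N h1
    have h2 : |A N (θ * tw) tw - B N (θ * tw) tw| ≤ ⨆ t : ℝ≥0, |A N t tw - B N t tw| :=
      le_ciSup (f := fun t : ℝ≥0 => |A N t tw - B N t tw|)
        ⟨2, by rintro _ ⟨t, rfl⟩; exact h1 t tw⟩ (θ * tw)
    have := abs_sub_le (A N (θ * tw) tw) (B N (θ * tw) tw) ℓ
    linarith
  · exact isCoboundedUnder_le_of_le atTop fun N => abs_nonneg _
  · exact isBoundedUnder_le_add (hbdB tw) (hbdS tw)
  · exact isBoundedUnder_of ⟨0, hnnB⟩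
  · exact isCoboundedUnder_le_of_le atTop hnnS

/-- The time `tw` has to be so large that the average of the mean waiting times truncated
at `tw` is large. -/
lemma eventually_meanRate_le {x : ℕ → ℝ} (hx : ∀ i, 0 < x i)
    (h : ∀ C : ℝ, ∃ k : ℝ, 0 ≤ k ∧ ∀ᶠ N : ℕ in atTop,
      C ≤ (∑ j ∈ Finset.range N, min k (x j)⁻¹) / N)
    {Ω' : ℕ → Type*} [∀ N, MeasurableSpace (Ω' N)] {μ : ∀ N, Measure (Ω' N)}
    {Y : ∀ N, ℝ≥0 → Ω' N → Fin N} (hY : ∀ N, 1 ≤ N → IsTrapWalk x N (μ N) (Y N))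
    {ε : ℝ} (hε : 0 < ε) :
    ∀ᶠ tw : ℝ≥0 in atTop, ∀ᶠ N in atTop, meanRate x N tw ≤ ε := by
  obtain ⟨k, hk, hev⟩ := h (2 / ε)
  filter_upwards [eventually_ge_atTop (⟨k, hk⟩ : ℝ≥0)] with tw htw
  have htw' : k ≤ tw := by exact_mod_cast htw
  filter_upwards [hev, eventually_ge_atTop 1] with N h1 hN
  have hv := (hY N hN).meanRate_nonneg hx tw
  have h2 := meanRate_mul_average_le hx hN tw.2 ((hY N hN).sum_occupation tw) hv
  have h3 : 2 / ε ≤ (∑ j ∈ Finset.range N, min (tw : ℝ) (x j)⁻¹) / N := by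
    refine h1.trans ?_
    gcongr
  have h4 := (mul_le_mul_of_nonneg_left h3 hv).trans h2
  rw [mul_div_assoc', div_le_iff₀ hε] at h4
  linarith

end Limits

end TrapModel

theorem proposition3p1 {Ω : Type*} [MeasurableSpace Ω] (P : Measure Ω)
    [IsProbabilityMeasure P] (α : ℝ) (hα₀ : 0 < α) (hα₁ : α < 1)
    (E : ℕ → Ω → ℝ) (hE : TrapModel.IsLandscape P α E) (δ : ℝ) (hδ : 0 < δ) :
    ∀ᵐ ω ∂P, ∀ x : ℕ → ℝ, x = TrapModel.rates (fun i => E i ω) →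
      ∀ (Ω' : ℕ → Type*) [∀ N, MeasurableSpace (Ω' N)] (μ : ∀ N, Measure (Ω' N))
        (Y : ∀ N, ℝ≥0 → Ω' N → Fin N),
        (∀ N, 1 ≤ N → TrapModel.IsTrapWalk x N (μ N) (Y N)) →
        TrapModel.AsympEqual (fun N => TrapModel.corr₁ x δ (μ N) (Y N))
          (fun N => TrapModel.corr (μ N) (Y N)) ∧
        TrapModel.AsympEqual (fun N => TrapModel.corr₂ x δ (μ N) (Y N))
          (fun N => TrapModel.corr (μ N) (Y N)) ∧
        ∀ (θ : ℝ≥0) (ℓ : ℝ), 0 < θ →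
          (TrapModel.AgesTo (fun N => TrapModel.corr₁ x δ (μ N) (Y N)) θ ℓ ↔
            TrapModel.AgesTo (fun N => TrapModel.corr (μ N) (Y N)) θ ℓ) ∧
          (TrapModel.AgesTo (fun N => TrapModel.corr₂ x δ (μ N) (Y N)) θ ℓ ↔
            TrapModel.AgesTo (fun N => TrapModel.corr (μ N) (Y N)) θ ℓ) := by
  classical
  filter_upwards [hE.ae_injective_rates, hE.ae_eventually_le_average hα₀ hα₁] with ω hinj hav
  rintro x rfl Ω' _ μ Y hY
  set x := TrapModel.rates fun i => E i ω with hxdef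
  have hx : ∀ i, 0 < x i := fun i => Real.exp_pos _
  have h1 : TrapModel.AsympEqual (fun N => TrapModel.corr₁ x δ (μ N) (Y N))
      (fun N => TrapModel.corr (μ N) (Y N)) := by
    refine TrapModel.asympEqual_of_forall_eventually fun ε hε => ?_
    filter_upwards [TrapModel.eventually_meanRate_le hx hav hY (mul_pos hε hδ)] with tw htw
    filter_upwards [htw, eventually_ge_atTop 1] with N hv hN t
    refine ((hY N hN).abs_corr₁_sub_corr_le hx hδ hN t tw).trans ?_
    rwa [div_le_iff₀ hδ]
  have h2 : TrapModel.AsympEqual (fun N => TrapModel.corr₂ x δ (μ N) (Y N))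
      (fun N => TrapModel.corr (μ N) (Y N)) := by
    refine TrapModel.asympEqual_of_forall_eventually fun ε hε => ?_
    filter_upwards [TrapModel.eventually_meanRate_le hx hav hY (mul_pos (half_pos hε) hδ)]
      with tw htw
    obtain ⟨M, hM⟩ := exists_nat_gt (4 / ε)
    have hM0 : (0 : ℝ) < M := (div_pos four_pos hε).trans hM
    filter_upwards [htw, eventually_ge_atTop 1,
      (TrapModel.tendsto_card_deep hδ hav).eventually_ge_atTop M] with N hv hN hcard t
    set B : Finset (Fin N) := Finset.univ.filter fun i => x i < δ with hB
    have hBcard : B.card = ((Finset.range N).filter fun j => x j < δ).card := by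
      rw [Finset.card_filter, Finset.card_filter,
        Fin.sum_univ_eq_sum_range fun j => if x j < δ then 1 else 0]
    have hMB : (M : ℝ) ≤ B.card := by rw [hBcard]; exact_mod_cast hcard
    have hne : B.Nonempty := Finset.card_pos.1 (by exact_mod_cast hM0.trans_le hMB)
    refine ((hY N hN).abs_corr₂_sub_corr_le hx hinj hδ hN B
      (fun i => by simp [hB, TrapModel.shallow]) hne t tw).trans ?_
    have hv' : TrapModel.meanRate x N tw / δ ≤ ε / 2 := by rwa [div_le_iff₀ hδ]
    have hm : 2 / (B.card : ℝ) ≤ ε / 2 := by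
      rw [div_lt_iff₀ hε] at hM
      rw [div_le_div_iff₀ (hM0.trans_le hMB) two_pos]
      nlinarith
    linarith
  have hbd : ∀ S : ∀ N, ℝ≥0 → ℝ≥0 → Set (Ω' N),
      ∀ᶠ N in atTop, ∀ t tw, |(μ N).real (S N t tw)| ≤ 1 := fun S => by
    filter_upwards [eventually_ge_atTop 1] with N hN t tw
    have := (hY N hN).isProbabilityMeasure
    rw [abs_of_nonneg measureReal_nonneg]
    exact measureReal_le_one
  exact ⟨h1, h2, fun θ ℓ _ =>
    ⟨⟨TrapModel.AgesTo.congr (hbd _) (hbd _) h1.symm, TrapModel.AgesTo.congr (hbd _) (hbd _) h1⟩,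
      ⟨TrapModel.AgesTo.congr (hbd _) (hbd _) h2.symm,
        TrapModel.AgesTo.congr (hbd _) (hbd _) h2⟩⟩⟩
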